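/- Let $n\ge 2$ and let $D_n$ be the set of all difunctional relations on $\{1,\dots,n\}$, that is, binary relations $\alpha$ with $\alpha=\alpha\circ\alpha^{-1}\circ\alpha$. Equivalently, $\alpha=(A_1\times B_1)\cup\dots\cup(A_k\times B_k)$ with $A_1,\dots,A_k\subseteq\{1,\dots,n\}$ nonempty and pairwise disjoint, and likewise $B_1,\dots,B_k$; the number $k\ge 0$ of blocks is denoted $\operatorname{rank}(\alpha)$. Under the operation $$\alpha\diamond\beta=\{(x,y) : x\alpha=\beta y\neq\emptyset\},\qquad x\alpha=\{z:(x,z)\in\alpha\},\quad \beta y=\{z:(z,y)\in\beta\},$$ $D_n$ is an (inverse) semigroup. For $0\le r\le n$ let $I_r=\{\alpha\in D_n:\operatorname{rank}(\alpha)\le r\}$, an ideal of $D_n$. Then the rank of the semigroup $I_r$, i.e. the least cardinality of a subset generating $I_r$ as a semigroup, is $$\operatorname{rank}(I_r)=\begin{cases}\rho_{nr} & \text{if } r=0 \text{ or } r\ge 3,\\ \rho_{nr}-1 & \text{if } r=1 \text{ or } r=2,\end{cases}\qquad\text{where}\qquad \rho_{nr}=r+(r+1)S(n,r+1)+\sum_{k=1}^{r}S(n,k)$$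 and $S(n,k)$ denotes the Stirling number of the second kind, the number of partitions of an $n$-element set into $k$ nonempty blocks. -/

import Mathlib

/-- The relation `α ◇ β = {(x, y) | xα = βy ≠ ∅}`, where `xα = {z | (x, z) ∈ α}` and
`βy = {z | (z, y) ∈ β}`. -/
def SetRel.dia {X : Type*} (α β : SetRel X X) : SetRel X X :=
  {p | {z | (p.1, z) ∈ α} = {z | (z, p.2) ∈ β} ∧ {z | (p.1, z) ∈ α}.Nonempty}

/-- A relation is difunctional if `α = α ∘ α⁻¹ ∘ α`. -/
def SetRel.IsDifunctional {X : Type*} (α : SetRel X X) : Prop :=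
  α = (α.comp α.inv).comp α

theorem SetRel.isDifunctional_iff {X : Type*} (α : SetRel X X) :
    α.IsDifunctional ↔
      ∀ a b c d, (a, b) ∈ α → (c, b) ∈ α → (c, d) ∈ α → (a, d) ∈ α := by
  constructor
  · intro h a b c d h1 h2 h3
    rw [h]
    exact ⟨c, ⟨b, h1, h2⟩, h3⟩
  · intro h
    apply Set.Subset.antisymm
    · rintro ⟨a, b⟩ hab
      exact ⟨a, ⟨b, hab, hab⟩, hab⟩
    · rintro ⟨a, d⟩ ⟨c, ⟨b, h1, h2⟩, h3⟩
      exact h a b c d h1 h2 h3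

/-- The kernel of a difunctional relation `α = (A₁ × B₁) ∪ ⋯ ∪ (A_r × B_r)`, namely the set
`{A₁, …, A_r}`: it consists of the nonempty sets of the form `αy = {x | (x, y) ∈ α}`. -/
def SetRel.kernel {X : Type*} (α : SetRel X X) : Set (Set X) :=
  {A | A.Nonempty ∧ ∃ y, A = {x | (x, y) ∈ α}}

/-- The rank of a difunctional relation on a finite set: the number of its blocks. -/
noncomputable def SetRel.blockRank {X : Type*} (α : SetRel X X) : ℕ :=
  α.kernel.ncard

/-- The rank of `(A₁ × B₁) ∪ ⋯ ∪ (A_r × B_r)` is `r`, when the `A_i` are nonempty and pairwise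
disjoint, and so are the `B_i`. -/
theorem SetRel.blockRank_eq {X : Type*} (α : SetRel X X) (r : ℕ) (A B : Fin r → Set X)
    (hA : ∀ i, (A i).Nonempty) (hB : ∀ i, (B i).Nonempty)
    (hA' : Pairwise (fun i j => Disjoint (A i) (A j)))
    (hB' : Pairwise (fun i j => Disjoint (B i) (B j)))
    (hα : α = ⋃ i, A i ×ˢ B i) : α.blockRank = r := by
  have hcol : ∀ i, ∀ y ∈ B i, {x | (x, y) ∈ α} = A i := by
    intro i y hy
    ext x
    simp only [hα, Set.mem_ofPred_eq, Set.mem_iUnion, Set.mem_prod]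
    constructor
    · rintro ⟨j, hx, hj⟩
      by_cases hij : i = j
      · exact hij ▸ hx
      · exact absurd hj (Set.disjoint_left.1 (hB' hij) hy)
    · intro hx
      exact ⟨i, hx, hy⟩
  have hker : α.kernel = Set.range A := by
    ext S
    constructor
    · rintro ⟨⟨x, hx⟩, y, rfl⟩
      have hx' := hx
      simp only [hα, Set.mem_ofPred_eq, Set.mem_iUnion, Set.mem_prod] at hx'
      obtain ⟨i, _, hy⟩ := hx'
      exact ⟨i, (hcol i y hy).symm⟩
    · rintro ⟨i, rfl⟩
      obtain ⟨y, hy⟩ := hB i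
      exact ⟨hA i, y, (hcol i y hy).symm⟩
  have hinj : Function.Injective A := by
    intro i j hij
    by_contra hne
    obtain ⟨x, hx⟩ := hA i
    exact Set.disjoint_left.1 (hA' hne) hx (hij ▸ hx)
  rw [SetRel.blockRank, hker, Set.ncard_range_of_injective hinj, Nat.card_fin]

/-- The set `D_n` of all difunctional relations on an `n`-element set. -/
@[ext]
structure DifunRel (n : ℕ) where
  rel : SetRel (Fin n) (Fin n)
  isDifunctional : rel.IsDifunctional

namespace DifunRel

theorem dia_isDifunctional {X : Type*} (α β : SetRel X X) : (α.dia β).IsDifunctional := by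
  rw [SetRel.isDifunctional_iff]
  rintro a b c d ⟨h1, h1'⟩ ⟨h2, _⟩ ⟨h3, _⟩
  exact ⟨h1.trans (h2.symm.trans h3), h1'⟩

instance (n : ℕ) : Mul (DifunRel n) :=
  ⟨fun α β => ⟨α.rel.dia β.rel, dia_isDifunctional _ _⟩⟩

theorem mul_rel {n : ℕ} (α β : DifunRel n) : (α * β).rel = α.rel.dia β.rel := rfl

theorem row_eq {n : ℕ} (α : DifunRel n) {a b c : Fin n} (h : (a, b) ∈ α.rel)
    (h' : (c, b) ∈ α.rel) : {z | (a, z) ∈ α.rel} = {z | (c, z) ∈ α.rel} := by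
  have hd := (SetRel.isDifunctional_iff _).1 α.isDifunctional
  ext z
  exact ⟨fun hz => hd _ _ _ _ h' h hz, fun hz => hd _ _ _ _ h h' hz⟩

theorem col_eq {n : ℕ} (α : DifunRel n) {a b c : Fin n} (h : (a, b) ∈ α.rel)
    (h' : (a, c) ∈ α.rel) : {z | (z, b) ∈ α.rel} = {z | (z, c) ∈ α.rel} := by
  have hd := (SetRel.isDifunctional_iff _).1 α.isDifunctional
  ext z
  exact ⟨fun hz => hd _ _ _ _ hz h h', fun hz => hd _ _ _ _ hz h' h⟩

theorem mul_assoc_left {n : ℕ} (α β γ : DifunRel n) (x y : Fin n) :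
    (x, y) ∈ (α * β * γ).rel ↔ ∃ b c, (b, c) ∈ β.rel ∧
      {z | (x, z) ∈ α.rel} = {z | (z, c) ∈ β.rel} ∧
      {z | (b, z) ∈ β.rel} = {z | (z, y) ∈ γ.rel} := by
  have key : ∀ b c, (b, c) ∈ β.rel → {z | (x, z) ∈ α.rel} = {z | (z, c) ∈ β.rel} →
      {z | (x, z) ∈ (α * β).rel} = {z | (b, z) ∈ β.rel} := by
    intro b c hbc h
    ext z
    constructor
    · rintro ⟨h1, _⟩
      have : b ∈ {w | (w, z) ∈ β.rel} := h1 ▸ (h ▸ hbc : b ∈ {w | (x, w) ∈ α.rel})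
      exact this
    · intro hz
      exact ⟨h.trans (β.col_eq hbc hz), b, (h ▸ hbc : b ∈ {w | (x, w) ∈ α.rel})⟩
  constructor
  · rintro ⟨h, c, hc⟩
    obtain ⟨h1, b, hb⟩ := hc
    have hbc : (b, c) ∈ β.rel := (h1 ▸ hb : b ∈ {w | (w, c) ∈ β.rel})
    exact ⟨b, c, hbc, h1, (key b c hbc h1).symm.trans h⟩
  · rintro ⟨b, c, hbc, h1, h2⟩
    refine ⟨(key b c hbc h1).trans h2, c, ?_⟩
    change c ∈ {z | (x, z) ∈ (α * β).rel}
    rw [key b c hbc h1]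
    exact hbc

theorem mul_assoc_right {n : ℕ} (α β γ : DifunRel n) (x y : Fin n) :
    (x, y) ∈ (α * (β * γ)).rel ↔ ∃ b c, (b, c) ∈ β.rel ∧
      {z | (x, z) ∈ α.rel} = {z | (z, c) ∈ β.rel} ∧
      {z | (b, z) ∈ β.rel} = {z | (z, y) ∈ γ.rel} := by
  have key : ∀ b c, (b, c) ∈ β.rel → {z | (b, z) ∈ β.rel} = {z | (z, y) ∈ γ.rel} →
      {z | (z, y) ∈ (β * γ).rel} = {z | (z, c) ∈ β.rel} := by
    intro b c hbc h
    ext z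
    constructor
    · rintro ⟨h1, _⟩
      have : c ∈ {w | (z, w) ∈ β.rel} := by
        have h3 : {w | (z, w) ∈ β.rel} = {w | (b, w) ∈ β.rel} := h1.trans h.symm
        rw [h3]
        exact hbc
      exact this
    · intro hz
      exact ⟨(β.row_eq hz hbc).trans h, c, hz⟩
  constructor
  · rintro ⟨h, b, hb⟩
    have hb' : b ∈ {z | (z, y) ∈ (β * γ).rel} := h ▸ hb
    obtain ⟨h1, c, hbc⟩ := hb'
    exact ⟨b, c, hbc, h.trans (key b c hbc h1), h1⟩
  · rintro ⟨b, c, hbc, h1, h2⟩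
    refine ⟨h1.trans (key b c hbc h2).symm, b, ?_⟩
    change b ∈ {z | (x, z) ∈ α.rel}
    rw [h1]
    exact hbc

/-- The semigroup `(D_n, ◇)`. -/
instance (n : ℕ) : Semigroup (DifunRel n) where
  mul_assoc α β γ := by
    ext ⟨x, y⟩
    rw [mul_assoc_left, mul_assoc_right]

/-- The rank of a difunctional relation. -/
noncomputable def rank {n : ℕ} (α : DifunRel n) : ℕ := α.rel.blockRank

theorem rank_mul_le_left {n : ℕ} (α β : DifunRel n) : (α * β).rank ≤ α.rank := by
  refine Set.ncard_le_ncard ?_ (Set.toFinite _)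
  rintro A ⟨hA, y, rfl⟩
  refine ⟨hA, ?_⟩
  obtain ⟨x, hx, z, hz⟩ := hA
  refine ⟨z, ?_⟩
  ext w
  constructor
  · rintro ⟨hw, _⟩
    have : z ∈ {v | (w, v) ∈ α.rel} := by
      have h3 : {v | (w, v) ∈ α.rel} = {v | (x, v) ∈ α.rel} := hw.trans hx.symm
      rw [h3]
      exact hz
    exact this
  · intro hw
    exact ⟨(α.row_eq hw hz).trans hx, z, hw⟩

theorem rank_mul_le_right {n : ℕ} (α β : DifunRel n) : (α * β).rank ≤ β.rank := by
  refine le_trans (Set.ncard_le_ncard ?_ (Set.toFinite _))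
    (Set.ncard_image_le (f := fun B : Set (Fin n) => {x | {z | (x, z) ∈ α.rel} = B})
      (Set.toFinite β.rel.kernel))
  rintro A ⟨⟨x, hx⟩, y, rfl⟩
  have hne : {z | (z, y) ∈ β.rel}.Nonempty := hx.1 ▸ hx.2
  refine ⟨{z | (z, y) ∈ β.rel}, ⟨hne, y, rfl⟩, ?_⟩
  ext w
  constructor
  · intro hw
    have hw' : {z | (w, z) ∈ α.rel} = {z | (z, y) ∈ β.rel} := hw
    exact ⟨hw', hw'.symm ▸ hne⟩
  · intro hw
    exact hw.1

/-- The ideal `I_r = {α ∈ D_n | rank α ≤ r}` of `D_n`, as a subsemigroup; by `rank_mul_le_left`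
and `rank_mul_le_right` it is indeed a two-sided ideal. -/
def idealRank (n r : ℕ) : Subsemigroup (DifunRel n) where
  carrier := {α | α.rank ≤ r}
  mul_mem' {α β} hα _ := le_trans (rank_mul_le_left α β) hα

end DifunRel

/-- The rank of a semigroup: the least cardinality of a generating set. -/
noncomputable def Semigroup.rank (S : Type*) [Semigroup S] : Cardinal :=
  sInf {c | ∃ A : Set S, Subsemigroup.closure A = ⊤ ∧ Cardinal.mk A = c}

/-- `ρ_{nr} = r + (r + 1) S(n, r + 1) + ∑_{k = 1}^r S(n, k)`, with `S` the Stirling numbers of the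
second kind. -/
def difunRho (n r : ℕ) : ℕ :=
  r + (r + 1) * Nat.stirlingSecond n (r + 1) + ∑ k ∈ Finset.Icc 1 r, Nat.stirlingSecond n k

/-! A difunctional relation of rank `k` is a bijection between the blocks of two partial partitions
with `k` blocks each, its kernel and its cokernel. The product composes these bijections along the
blocks that literally coincide as sets. Hence the elements of rank `k` together with composition
that keeps the rank form a connected groupoid: its objects are the partial partitions with `k`
blocks, and its vertex groups are symmetric groups on `k` letters. A partial partition that does not
cover becomes a covering one with one more block by adding the complement, so there are `S(n,k) +
(k+1) S(n,k+1)` objects.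

In the top rank `r`, every object must be the kernel of some generator. A cycle through all objects
whose monodromy is an `r`-cycle achieves this bound when `r ≤ 2`, since the symmetric group is then
cyclic. For `r ≥ 3` one extra loop suffices. It is also necessary: with a single generator per
kernel, a product of rank `r` would be determined by its kernel and its length, which would force
the symmetric group to be commutative (`isProd_unique`).

In a rank `k` with `1 ≤ k < r`, restricting elements of rank `k + 1` supplies the passage between
non-covering objects. Each of the `S(n,k)` covering objects still has to be the kernel of a
generator, and one more generator must lead out of the non-covering ones; a cycle through one
non-covering object and all covering ones suffices (`link_mem_of_cycle`). The empty relation costs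
nothing when `r ≥ 1`, being a product of two elements of rank 1. Adding up gives `generatorCount`.
-/

/-- A `k`-tuple of nonempty pairwise disjoint subsets of `{1, …, n}`: an ordered partial partition
into `k` blocks. -/
@[ext]
structure Frame (n k : ℕ) where
  toFun : Fin k → Set (Fin n)
  nonempty : ∀ i, (toFun i).Nonempty
  disjoint : Pairwise fun i j => Disjoint (toFun i) (toFun j)

/-! ### Ordered partial partitions and their reorderings -/

namespace Frame

variable {n k m : ℕ}

instance : CoeFun (Frame n k) fun _ => Fin k → Set (Fin n) := ⟨toFun⟩

theorem toFun_injective : Function.Injective (toFun : Frame n k → Fin k → Set (Fin n)) :=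
  fun _ _ h => Frame.ext h

instance : Finite (Frame n k) := Finite.of_injective _ toFun_injective

theorem index_eq (f : Frame n k) {i j : Fin k} {x : Fin n} (hi : x ∈ f i) (hj : x ∈ f j) :
    i = j := by
  by_contra h
  exact Set.disjoint_left.1 (f.disjoint h) hi hj

theorem injective (f : Frame n k) : Function.Injective f := by
  intro i j h
  obtain ⟨x, hx⟩ := f.nonempty i
  exact f.index_eq hx (h ▸ hx)

/-- The subtuple of a frame along an injection of index sets. -/
@[simps]
def restrict (f : Frame n k) (e : Fin m ↪ Fin k) : Frame n m where
  toFun i := f (e i)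
  nonempty _ := f.nonempty _
  disjoint _ _ h := f.disjoint fun h' => h (e.injective h')

/-- The reordering of a frame by a permutation of its index set. -/
def perm (f : Frame n k) (σ : Equiv.Perm (Fin k)) : Frame n k := f.restrict σ.toEmbedding

@[simp]
theorem perm_apply (f : Frame n k) (σ : Equiv.Perm (Fin k)) (i : Fin k) :
    f.perm σ i = f (σ i) := rfl

theorem perm_perm (f : Frame n k) (σ τ : Equiv.Perm (Fin k)) :
    (f.perm σ).perm τ = f.perm (σ * τ) := rfl

@[simp]
theorem perm_one (f : Frame n k) : f.perm 1 = f := rfl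

/-- The blocks are distinct, so permutations act freely on frames. This gives the factor `k!`
between ordered and unordered partial partitions. -/
theorem perm_injective (f : Frame n k) : Function.Injective f.perm := by
  intro σ τ h
  ext1 i
  exact f.injective (congrArg (fun g : Frame n k => g i) h)

@[simp]
theorem range_perm (f : Frame n k) (σ : Equiv.Perm (Fin k)) :
    Set.range (f.perm σ) = Set.range f :=
  σ.surjective.range_comp f

theorem exists_perm_of_range_eq {f g : Frame n k} (h : Set.range f = Set.range g) :
    ∃ σ, g = f.perm σ := by
  have hg : ∀ i, ∃ j, f j = g i := fun i => by
    have : g i ∈ Set.range f := h ▸ Set.mem_range_self i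
    exact this
  choose s hs using hg
  have hinj : Function.Injective s := fun i j hij => g.injective (by rw [← hs, ← hs, hij])
  refine ⟨Equiv.ofBijective s (Finite.injective_iff_bijective.1 hinj), Frame.ext ?_⟩
  funext i
  exact (hs i).symm

/-- A frame is full if its blocks cover the whole set. -/
def IsFull (f : Frame n k) : Prop := ∀ x, ∃ i, x ∈ f i

theorem isFull_iff_sUnion (f : Frame n k) : f.IsFull ↔ ⋃₀ Set.range f = Set.univ := by
  simp [IsFull, Set.eq_univ_iff_forall]

@[simp]
theorem isFull_perm (f : Frame n k) (σ : Equiv.Perm (Fin k)) : (f.perm σ).IsFull ↔ f.IsFull := by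
  rw [isFull_iff_sUnion, isFull_iff_sUnion, range_perm]

/-- The full frame obtained from a non-full one by adding the complement of the union of the
blocks as a new first block. -/
def extend (f : Frame n k) (hf : ¬ f.IsFull) : Frame n (k + 1) where
  toFun := Fin.cons {x | ∀ i, x ∉ f i} f
  nonempty i := by
    refine Fin.cases ?_ (fun i => ?_) i
    · simpa [IsFull, Set.Nonempty] using hf
    · simpa using f.nonempty i
  disjoint i j := by
    refine Fin.cases ?_ (fun i => ?_) i <;> refine Fin.cases ?_ (fun j => ?_) j
    · simp
    · intro _
      simp only [Fin.cons_zero, Fin.cons_succ]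
      exact Set.disjoint_left.2 fun x hx hx' => hx j hx'
    · intro _
      simp only [Fin.cons_zero, Fin.cons_succ]
      exact Set.disjoint_left.2 fun x hx hx' => hx' i hx
    · intro h
      simpa using f.disjoint fun h' => h (by rw [h'])

theorem isFull_extend (f : Frame n k) (hf : ¬ f.IsFull) : (f.extend hf).IsFull := by
  intro x
  by_cases h : ∃ i, x ∈ f i
  · obtain ⟨i, hi⟩ := h
    exact ⟨i.succ, by simpa [extend] using hi⟩
  · exact ⟨0, by simpa [extend] using h⟩

theorem not_isFull_restrict_succ (f : Frame n (k + 1)) :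
    ¬ (f.restrict (Fin.succEmb k)).IsFull := by
  intro h
  obtain ⟨x, hx⟩ := f.nonempty 0
  obtain ⟨i, hi⟩ := h x
  exact Fin.succ_ne_zero i (f.index_eq hi hx)

theorem restrict_extend (f : Frame n k) (hf : ¬ f.IsFull) :
    (f.extend hf).restrict (Fin.succEmb k) = f := by
  ext1
  funext i
  simp [extend]

theorem extend_restrict (f : Frame n (k + 1)) (hf : f.IsFull) :
    (f.restrict (Fin.succEmb k)).extend f.not_isFull_restrict_succ = f := by
  ext1
  funext i
  refine Fin.cases ?_ (fun i => ?_) i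
  · ext x
    simp only [extend, restrict, Fin.cons_zero, Set.mem_ofPred_eq]
    constructor
    · intro h
      obtain ⟨j, hj⟩ := hf x
      revert hj
      refine Fin.cases (fun hj => hj) (fun j hj => absurd hj (h j)) j
    · intro h j hj
      exact Fin.succ_ne_zero j (f.index_eq hj h)
  · simp [extend]

/-- The frame of the first `k` singletons. -/
def singletons (h : k ≤ n) : Frame n k where
  toFun i := {Fin.castLE h i}
  nonempty _ := Set.singleton_nonempty _
  disjoint i j hij := by simpa using hij

theorem not_isFull_singletons (h : k < n) : ¬ (singletons h.le).IsFull := by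
  intro hf
  obtain ⟨i, hi⟩ := hf ⟨k, h⟩
  simp only [singletons, Set.mem_singleton_iff, Fin.ext_iff, Fin.val_castLE] at hi
  exact i.2.ne hi.symm

end Frame

/-! ### Difunctional relations as bijections between blocks -/

namespace DifunRel

variable {n k m : ℕ}

instance : Finite (DifunRel n) := by
  have : Finite (SetRel (Fin n) (Fin n)) := inferInstanceAs (Finite (Set (Fin n × Fin n)))
  exact Finite.of_injective rel fun _ _ h => DifunRel.ext h

/-- The difunctional relation `⋃ i, f i × g i`. -/
def link (f g : Frame n k) : DifunRel n where
  rel := ⋃ i, f i ×ˢ g i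
  isDifunctional := by
    rw [SetRel.isDifunctional_iff]
    intro a b c d h1 h2 h3
    simp only [Set.mem_iUnion, Set.mem_prod] at *
    obtain ⟨i, ha, hb⟩ := h1
    obtain ⟨j, hc, hb'⟩ := h2
    obtain ⟨l, hc', hd⟩ := h3
    obtain rfl := g.index_eq hb hb'
    obtain rfl := f.index_eq hc hc'
    exact ⟨i, ha, hd⟩

theorem mem_link {f g : Frame n k} {x y : Fin n} :
    (x, y) ∈ (link f g).rel ↔ ∃ i, x ∈ f i ∧ y ∈ g i := by
  simp [link, Set.mem_iUnion]

theorem link_row {f g : Frame n k} {i : Fin k} {x : Fin n} (hx : x ∈ f i) :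
    {y | (x, y) ∈ (link f g).rel} = g i := by
  ext y
  simp only [Set.mem_ofPred_eq, mem_link]
  exact ⟨fun ⟨j, hj, hy⟩ => f.index_eq hx hj ▸ hy, fun hy => ⟨i, hx, hy⟩⟩

theorem link_col {f g : Frame n k} {i : Fin k} {y : Fin n} (hy : y ∈ g i) :
    {x | (x, y) ∈ (link f g).rel} = f i := by
  ext x
  simp only [Set.mem_ofPred_eq, mem_link]
  exact ⟨fun ⟨j, hx, hj⟩ => g.index_eq hy hj ▸ hx, fun hx => ⟨i, hx, hy⟩⟩

theorem mem_mul {α β : DifunRel n} {x y : Fin n} :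
    (x, y) ∈ (α * β).rel ↔
      {z | (x, z) ∈ α.rel} = {z | (z, y) ∈ β.rel} ∧ {z | (x, z) ∈ α.rel}.Nonempty := Iff.rfl

/-- Blocks of one frame that meet are equal, so the blocks matched by the product are exactly those
selected by `e`. This is how elements of higher rank act on those of lower rank. -/
theorem link_mul_link_restrict (f g : Frame n k) (e : Fin m ↪ Fin k) (h : Frame n m) :
    link f g * link (g.restrict e) h = link (f.restrict e) h := by
  ext ⟨x, y⟩
  rw [mem_mul, mem_link]
  constructor
  · rintro ⟨heq, z, hz⟩
    have hz' : (z, y) ∈ (link (g.restrict e) h).rel := (Set.ext_iff.1 heq z).1 hz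
    obtain ⟨i, hx, hzi⟩ := mem_link.1 hz
    obtain ⟨j, hzj, hy⟩ := mem_link.1 hz'
    obtain rfl : i = e j := g.index_eq hzi hzj
    exact ⟨j, hx, hy⟩
  · rintro ⟨j, hx, hy⟩
    have hx' : x ∈ f (e j) := hx
    rw [link_row hx', link_col hy]
    exact ⟨rfl, g.nonempty _⟩

theorem link_restrict_mul_link (f g : Frame n k) (e : Fin m ↪ Fin k) (h : Frame n m) :
    link h (f.restrict e) * link f g = link h (g.restrict e) := by
  ext ⟨x, y⟩
  rw [mem_mul, mem_link]
  constructor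
  · rintro ⟨heq, z, hz⟩
    have hz' : (z, y) ∈ (link f g).rel := (Set.ext_iff.1 heq z).1 hz
    obtain ⟨i, hx, hzi⟩ := mem_link.1 hz
    obtain ⟨j, hzj, hy⟩ := mem_link.1 hz'
    obtain rfl : e i = j := f.index_eq hzi hzj
    exact ⟨i, hx, hy⟩
  · rintro ⟨j, hx, hy⟩
    have hy' : y ∈ g (e j) := hy
    rw [link_row hx, link_col hy']
    exact ⟨rfl, f.nonempty _⟩

theorem link_mul_link (f g h : Frame n k) : link f g * link g h = link f h :=
  link_mul_link_restrict f g (Function.Embedding.refl _) h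

/-- Only the pairing of blocks matters, not their common numbering. -/
theorem link_perm_perm (f g : Frame n k) (σ : Equiv.Perm (Fin k)) :
    link (f.perm σ) (g.perm σ) = link f g := by
  ext ⟨x, y⟩
  simp only [mem_link, Frame.perm_apply]
  exact ⟨fun ⟨i, h⟩ => ⟨σ i, h⟩, fun ⟨i, h⟩ => ⟨σ.symm i, by simpa using h⟩⟩

theorem link_right_injective {f g h : Frame n k} (H : link f g = link f h) : g = h := by
  ext1
  funext i
  obtain ⟨x, hx⟩ := f.nonempty i
  rw [← link_row (g := g) hx, H, link_row hx]

theorem rank_link (f g : Frame n k) : (link f g).rank = k :=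
  SetRel.blockRank_eq _ k f g f.nonempty g.nonempty f.disjoint g.disjoint rfl

/-- The set `{B₁, …, B_k}` of right blocks of `(A₁ × B₁) ∪ ⋯ ∪ (A_k × B_k)`. -/
def cokernel (α : DifunRel n) : Set (Set (Fin n)) :=
  {B | B.Nonempty ∧ ∃ x, B = {y | (x, y) ∈ α.rel}}

theorem kernel_link (f g : Frame n k) : (link f g).rel.kernel = Set.range f := by
  ext A
  constructor
  · rintro ⟨⟨x, hx⟩, y, rfl⟩
    obtain ⟨i, _, hy⟩ := mem_link.1 hx
    exact ⟨i, (link_col hy).symm⟩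
  · rintro ⟨i, rfl⟩
    obtain ⟨y, hy⟩ := g.nonempty i
    exact ⟨f.nonempty i, y, (link_col hy).symm⟩

theorem cokernel_link (f g : Frame n k) : (link f g).cokernel = Set.range g := by
  ext A
  constructor
  · rintro ⟨⟨y, hy⟩, x, rfl⟩
    obtain ⟨i, hx, _⟩ := mem_link.1 hy
    exact ⟨i, (link_row hx).symm⟩
  · rintro ⟨i, rfl⟩
    obtain ⟨x, hx⟩ := f.nonempty i
    exact ⟨g.nonempty i, x, (link_row hx).symm⟩

/-- Number the blocks of the kernel and pick a point `x i` in each; the right block paired with it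
is the row of `x i`. Difunctionality makes rows through a common column equal, so the choice is
harmless and the rows are disjoint. -/
theorem exists_link (α : DifunRel n) : ∃ f g : Frame n α.rank, α = link f g := by
  obtain ⟨e⟩ : Nonempty (Fin α.rank ≃ α.rel.kernel) :=
    ⟨(Finite.equivFinOfCardEq (Nat.card_coe_set_eq _)).symm⟩
  have hx : ∀ i, ∃ x y, x ∈ (e i : Set (Fin n)) ∧ (e i : Set (Fin n)) = {z | (z, y) ∈ α.rel} :=
    fun i => by
      obtain ⟨⟨x, hx⟩, y, hy⟩ := (e i).2
      exact ⟨x, y, hx, hy⟩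
  choose x y hx hy using hx
  have hxy : ∀ i, (x i, y i) ∈ α.rel := fun i => by
    have := hx i
    rw [hy i] at this
    exact this
  have hdiff := (SetRel.isDifunctional_iff _).1 α.isDifunctional
  refine ⟨⟨fun i => e i, fun i => ⟨x i, hx i⟩, fun i j hij => ?_⟩,
    ⟨fun i => {z | (x i, z) ∈ α.rel}, fun i => ⟨y i, hxy i⟩, fun i j hij => ?_⟩, ?_⟩
  · refine Set.disjoint_left.2 fun z hz hz' => hij ?_
    rw [hy i] at hz
    rw [hy j] at hz'
    refine e.injective (Subtype.ext ?_)
    rw [hy i, hy j]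
    exact α.col_eq hz hz'
  · refine Set.disjoint_left.2 fun z hz hz' => hij ?_
    refine e.injective (Subtype.ext ?_)
    rw [hy i, hy j]
    exact α.col_eq (hxy i) (hdiff _ _ _ _ hz hz' (hxy j))
  · ext ⟨a, b⟩
    rw [mem_link]
    constructor
    · intro hab
      obtain ⟨i, hi⟩ := e.surjective ⟨{z | (z, b) ∈ α.rel}, ⟨a, hab⟩, b, rfl⟩
      have hi' : (e i : Set (Fin n)) = {z | (z, b) ∈ α.rel} := by rw [hi]
      have h1 := hx i
      rw [hi'] at h1
      exact ⟨i, by simpa [hi'] using hab, h1⟩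
    · rintro ⟨i, ha, hb⟩
      have ha' : a ∈ {z | (z, y i) ∈ α.rel} := hy i ▸ ha
      exact hdiff _ _ _ _ ha' (hxy i) hb

theorem ncard_cokernel (α : DifunRel n) : α.cokernel.ncard = α.rank := by
  obtain ⟨f, g, h⟩ := α.exists_link
  generalize α.rank = k at f g h
  subst h
  rw [cokernel_link, Set.ncard_range_of_injective g.injective, Nat.card_fin]

theorem rank_eq_ncard_kernel (α : DifunRel n) : α.rank = α.rel.kernel.ncard := rfl

theorem kernel_mul_subset (α β : DifunRel n) : (α * β).rel.kernel ⊆ α.rel.kernel := by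
  rintro A ⟨hA, y, rfl⟩
  refine ⟨hA, ?_⟩
  obtain ⟨x, hx, z, hz⟩ := hA
  refine ⟨z, Set.ext fun w => ⟨fun ⟨hw, _⟩ => ?_, fun hw => ⟨(α.row_eq hw hz).trans hx, z, hw⟩⟩⟩
  exact (Set.ext_iff.1 (hw.trans hx.symm) z).2 hz

theorem cokernel_mul_subset (α β : DifunRel n) : (α * β).cokernel ⊆ β.cokernel := by
  rintro B ⟨hB, x, rfl⟩
  refine ⟨hB, ?_⟩
  obtain ⟨y, hy, z, hz⟩ := hB
  have hz' : (z, y) ∈ β.rel := (Set.ext_iff.1 hy z).1 hz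
  refine ⟨z, Set.ext fun w => ⟨fun ⟨hw, _⟩ => (Set.ext_iff.1 hw z).1 hz, fun hw => ?_⟩⟩
  exact ⟨hy.trans (β.col_eq hz' hw), z, hz⟩

theorem kernel_mul_eq {α β : DifunRel n} (h : α.rank ≤ (α * β).rank) :
    (α * β).rel.kernel = α.rel.kernel :=
  Set.eq_of_subset_of_ncard_le (kernel_mul_subset α β) h (Set.toFinite _)

theorem cokernel_mul_eq {α β : DifunRel n} (h : β.rank ≤ (α * β).rank) :
    (α * β).cokernel = β.cokernel :=
  Set.eq_of_subset_of_ncard_le (cokernel_mul_subset α β)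
    (by rwa [ncard_cokernel, ncard_cokernel]) (Set.toFinite _)

/-- If the rank of `β` survives, each right block of `β` is still a right block of the product. The
left block paired with it must then have been matched by a right block of `α`. -/
theorem kernel_subset_cokernel {α β : DifunRel n} (h : β.rank ≤ (α * β).rank) :
    β.rel.kernel ⊆ α.cokernel := by
  rintro A ⟨⟨x, hx⟩, y, rfl⟩
  have hB : {z | (x, z) ∈ β.rel} ∈ (α * β).cokernel :=
    cokernel_mul_eq h ▸ ⟨⟨y, hx⟩, x, rfl⟩
  obtain ⟨-, w, hw⟩ := hB
  have hy : (w, y) ∈ (α * β).rel := (Set.ext_iff.1 hw y).1 hx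
  exact ⟨⟨x, hx⟩, w, hy.1.symm⟩

theorem cokernel_eq_kernel {α β : DifunRel n} (h : β.rank ≤ (α * β).rank)
    (h' : α.rank ≤ β.rank) : β.rel.kernel = α.cokernel :=
  Set.eq_of_subset_of_ncard_le (kernel_subset_cokernel h)
    (by rw [ncard_cokernel]; exact h') (Set.toFinite _)

/-- A subfamily of the kernel that covers everything is the whole kernel. -/
theorem kernel_eq_of_subset {α : DifunRel n} {P : Set (Set (Fin n))} (hP : ⋃₀ P = Set.univ)
    (h : P ⊆ α.rel.kernel) : P = α.rel.kernel := by
  refine h.antisymm ?_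
  rintro A ⟨⟨x, hx⟩, y, rfl⟩
  obtain ⟨B, hB, hxB⟩ : x ∈ ⋃₀ P := hP ▸ Set.mem_univ x
  obtain ⟨-, z, rfl⟩ := h hB
  rwa [α.col_eq hx hxB]

theorem cokernel_eq_of_subset {α : DifunRel n} {P : Set (Set (Fin n))} (hP : ⋃₀ P = Set.univ)
    (h : P ⊆ α.cokernel) : P = α.cokernel := by
  refine h.antisymm ?_
  rintro B ⟨⟨y, hy⟩, x, rfl⟩
  obtain ⟨C, hC, hyC⟩ : y ∈ ⋃₀ P := hP ▸ Set.mem_univ y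
  obtain ⟨-, z, rfl⟩ := h hC
  rwa [α.row_eq hy hyC]

end DifunRel

/-! ### Counting surjections by Stirling numbers -/

section Surjections

theorem Nat.card_fun_range_eq {ι α : Type*} [Finite ι] [Finite α] (s : Set α) :
    Nat.card {g : ι → α // Set.range g = s} =
      Nat.card {g : ι → s // Function.Surjective g} := by
  refine Nat.card_congr ⟨fun g => ⟨fun i => ⟨g.1 i, (Set.ext_iff.1 g.2 _).1 (Set.mem_range_self i)⟩, ?_⟩,
    fun g => ⟨fun i => g.1 i, ?_⟩, fun g => rfl, fun g => rfl⟩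
  · rintro ⟨a, ha⟩
    obtain ⟨i, hi⟩ : a ∈ Set.range g.1 := g.2.symm ▸ ha
    exact ⟨i, Subtype.ext hi⟩
  · ext a
    constructor
    · rintro ⟨i, rfl⟩
      exact (g.1 i).2
    · intro ha
      obtain ⟨i, hi⟩ := g.2 ⟨a, ha⟩
      exact ⟨i, congrArg Subtype.val hi⟩

/-- A surjection from an `n + 1`-element set restricts to a map from an `n`-element set that is
surjective or misses exactly the value of the first element. -/
theorem Fin.surjective_cons_iff {n : ℕ} {α : Type*} (a : α) (g : Fin n → α) :
    Function.Surjective (Fin.cons a g : Fin (n + 1) → α) ↔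
      Function.Surjective g ∨ Set.range g = {a}ᶜ := by
  rw [← Set.range_eq_univ, Fin.range_cons, ← Set.range_eq_univ]
  constructor
  · intro h
    by_cases ha : a ∈ Set.range g
    · exact Or.inl (by rwa [Set.insert_eq_of_mem ha] at h)
    · right
      ext b
      constructor
      · rintro hb rfl
        exact ha hb
      · intro hb
        have : b ∈ insert a (Set.range g) := h ▸ Set.mem_univ b
        exact this.resolve_left hb
  · rintro (h | h)
    · simp [h]
    · rw [h, ← Set.union_compl_self {a}]
      rfl

theorem Nat.card_surjective (n k : ℕ) {α : Type*} [Finite α] (h : Nat.card α = k) :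
    Nat.card {g : Fin n → α // Function.Surjective g} = k.factorial * Nat.stirlingSecond n k := by
  classical
  induction n generalizing k α with
  | zero =>
    cases k with
    | zero =>
      have : IsEmpty α := (Nat.card_eq_zero.1 h).resolve_right (not_infinite_iff_finite.2 ‹_›)
      have : Unique {g : Fin 0 → α // Function.Surjective g} :=
        ⟨⟨⟨finZeroElim, fun a => isEmptyElim a⟩⟩, fun g => Subtype.ext (Subsingleton.elim _ _)⟩
      simp
    | succ k =>
      have : Nonempty α := (Nat.card_pos_iff.1 (h ▸ Nat.succ_pos k)).1
      have : IsEmpty {g : Fin 0 → α // Function.Surjective g} :=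
        ⟨fun g => (g.2 (Classical.arbitrary α)).choose.elim0⟩
      simp
  | succ n ih =>
    have key : Nat.card {g : Fin (n + 1) → α // Function.Surjective g} =
        Nat.card (Σ a : α, ({g : Fin n → α // Function.Surjective g} ⊕
          {g : Fin n → α // Set.range g = {a}ᶜ})) := by
      have e1 : {g : Fin (n + 1) → α // Function.Surjective g} ≃
          {p : α × (Fin n → α) // Function.Surjective p.2 ∨ Set.range p.2 = {p.1}ᶜ} :=
        ((Fin.consEquiv fun _ : Fin (n + 1) => α).subtypeEquiv fun p =>
          (Fin.surjective_cons_iff p.1 p.2).symm).symm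
      have e2 : {p : α × (Fin n → α) // Function.Surjective p.2 ∨ Set.range p.2 = {p.1}ᶜ} ≃
          Σ a : α, {g : Fin n → α // Function.Surjective g ∨ Set.range g = {a}ᶜ} :=
        ⟨fun p => ⟨p.1.1, p.1.2, p.2⟩, fun p => ⟨(p.1, p.2.1), p.2.2⟩, fun _ => rfl, fun _ => rfl⟩
      refine Nat.card_congr ((e1.trans e2).trans (Equiv.sigmaCongrRight fun a =>
        subtypeOrEquiv _ _ (Pi.disjoint_iff.2 fun g => Prop.disjoint_iff.2 ?_)))
      by_contra hg
      have h1 := hg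
      have : a ∈ Set.range g := Set.range_eq_univ.2 h1.1 ▸ Set.mem_univ a
      rw [h1.2] at this
      exact this rfl
    have := Fintype.ofFinite α
    have hs : ∀ a : α, Nat.card ({g : Fin n → α // Function.Surjective g} ⊕
        {g : Fin n → α // Set.range g = {a}ᶜ}) =
        k.factorial * Nat.stirlingSecond n k +
          (k - 1).factorial * Nat.stirlingSecond n (k - 1) := by
      intro a
      rw [Nat.card_sum, ih k h, Nat.card_fun_range_eq, ih (k - 1)]
      rw [Nat.card_coe_set_eq, Set.ncard_compl, Set.ncard_singleton, h]
    rw [key, Nat.card_sigma, Finset.sum_congr rfl fun a _ => hs a, Finset.sum_const,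
      Finset.card_univ, ← Nat.card_eq_fintype_card, h, smul_eq_mul]
    -- For `k = 0` the truncated `k - 1` is harmless, because the outer factor `k` vanishes.
    -- Otherwise this is the Stirling recurrence multiplied by `k!`.
    cases k with
    | zero => simp
    | succ k =>
      rw [Nat.stirlingSecond_succ_succ, Nat.factorial_succ, Nat.add_sub_cancel]
      ring

end Surjections

/-! ### Counting partial partitions -/

namespace Frame

variable {n k : ℕ}

/-- Full frames of size `k` are surjections onto a `k`-element set. -/
theorem card_isFull : Nat.card {f : Frame n k // f.IsFull} =
    k.factorial * Nat.stirlingSecond n k := by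
  rw [← Nat.card_surjective n k (Nat.card_fin k)]
  symm
  refine Nat.card_congr (Equiv.ofBijective (fun g => ⟨⟨fun i => {x | g.1 x = i}, fun i => ?_,
    fun i j hij => ?_⟩, ?_⟩) ⟨?_, ?_⟩)
  · exact g.2 i
  · refine Set.disjoint_left.2 fun x hx hx' => hij ?_
    exact (Eq.symm hx).trans hx'
  · exact fun x => ⟨g.1 x, rfl⟩
  · intro g g' h
    ext1
    funext x
    have h1 := congrArg (fun f : {f : Frame n k // f.IsFull} => f.1 (g.1 x)) h
    exact ((Set.ext_iff.1 h1 x).1 rfl).symm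
  · rintro ⟨f, hf⟩
    have hf' := hf
    choose g hg using hf'
    refine ⟨⟨g, fun i => ?_⟩, ?_⟩
    · obtain ⟨x, hx⟩ := f.nonempty i
      exact ⟨x, f.index_eq (hg x) hx⟩
    · ext1
      ext1
      funext i
      ext x
      exact ⟨fun h : g x = i => h ▸ hg x, fun h => f.index_eq (hg x) h⟩

/-- Adding the complement as first block and deleting the first block are inverse to each other. -/
theorem card_not_isFull : Nat.card {f : Frame n k // ¬ f.IsFull} =
    (k + 1).factorial * Nat.stirlingSecond n (k + 1) := by
  rw [← card_isFull]
  exact Nat.card_congr ⟨fun f => ⟨f.1.extend f.2, f.1.isFull_extend f.2⟩,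
    fun f => ⟨f.1.restrict (Fin.succEmb k), f.1.not_isFull_restrict_succ⟩,
    fun f => Subtype.ext (f.1.restrict_extend f.2),
    fun f => Subtype.ext (f.1.extend_restrict f.2)⟩

theorem card_eq : Nat.card (Frame n k) = k.factorial *
    (Nat.stirlingSecond n k + (k + 1) * Nat.stirlingSecond n (k + 1)) := by
  classical
  rw [Nat.card_congr (Equiv.sumCompl (IsFull : Frame n k → Prop)).symm, Nat.card_sum,
    card_isFull, card_not_isFull, Nat.factorial_succ]
  ring

/-- A set of frames that is closed under reordering, counted through its underlying unordered
partial partitions. -/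
theorem card_subtype_eq (p : Frame n k → Prop) (hp : ∀ f σ, p (perm f σ) ↔ p f) :
    Nat.card {f // p f} = ((fun f : Frame n k => Set.range f) '' {f | p f}).ncard *
      k.factorial := by
  set O := (fun f : Frame n k => Set.range f) '' {f | p f} with hO
  have hs : ∀ P : O, ∃ f : Frame n k, p f ∧ Set.range f = P := fun P => P.2
  choose s hs hs' using hs
  have hk : k.factorial = Nat.card (Equiv.Perm (Fin k)) := by rw [Nat.card_perm, Nat.card_fin]
  rw [← Nat.card_coe_set_eq O, hk, ← Nat.card_prod]
  symm
  refine Nat.card_congr (Equiv.ofBijective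
    (fun x : O × Equiv.Perm (Fin k) => ⟨(s x.1).perm x.2, (hp _ _).2 (hs _)⟩) ⟨?_, ?_⟩)
  · rintro ⟨P, σ⟩ ⟨Q, τ⟩ h
    have h1 : (s P).perm σ = (s Q).perm τ := congrArg Subtype.val h
    obtain rfl : P = Q := by
      refine Subtype.ext ?_
      rw [← hs' P, ← hs' Q, ← range_perm (s P) σ, h1, range_perm]
    rw [(s P).perm_injective h1]
  · rintro ⟨f, hf⟩
    obtain ⟨σ, hσ⟩ := exists_perm_of_range_eq (hs' ⟨Set.range f, f, hf, rfl⟩)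
    exact ⟨(⟨Set.range f, f, hf, rfl⟩, σ), Subtype.ext hσ.symm⟩

variable (n k)

/-- The partial partitions with `k` blocks of an `n`-element set. -/
def partitions : Set (Set (Set (Fin n))) := Set.range fun f : Frame n k => Set.range f

/-- The partitions into `k` blocks of an `n`-element set. -/
def fullPartitions : Set (Set (Set (Fin n))) :=
  (fun f : Frame n k => Set.range f) '' {f | f.IsFull}

theorem ncard_partitions : (partitions n k).ncard =
    Nat.stirlingSecond n k + (k + 1) * Nat.stirlingSecond n (k + 1) := by
  have h := card_subtype_eq (n := n) (k := k) (fun _ => True) fun _ _ => Iff.rfl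
  rw [Nat.card_congr (Equiv.subtypeUnivEquiv fun _ => trivial), card_eq] at h
  have h' : (fun f : Frame n k => Set.range f) '' {f | True} = partitions n k := by
    simp [partitions]
  rw [h', mul_comm] at h
  exact (Nat.eq_of_mul_eq_mul_right k.factorial_pos h).symm

theorem ncard_fullPartitions : (fullPartitions n k).ncard = Nat.stirlingSecond n k := by
  have h := card_subtype_eq (n := n) (k := k) IsFull isFull_perm
  rw [card_isFull, mul_comm] at h
  exact (Nat.eq_of_mul_eq_mul_right k.factorial_pos h).symm

end Frame

/-! ### Upper bound: generating sets from cycles of frames -/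

namespace DifunRel

variable {n k N : ℕ} {S : Subsemigroup (DifunRel n)}

theorem link_trans {f g h : Frame n k} (h1 : link f g ∈ S) (h2 : link g h ∈ S) :
    link f h ∈ S :=
  link_mul_link f g h ▸ S.mul_mem h1 h2

theorem link_perm_pow_mem {f : Frame n k} {σ : Equiv.Perm (Fin k)}
    (h : link f (f.perm σ) ∈ S) (m : ℕ) : link f (f.perm (σ ^ (m + 1))) ∈ S := by
  induction m with
  | zero => simpa using h
  | succ m ih =>
    refine link_trans ih ?_
    rw [pow_succ' σ (m + 1), ← Frame.perm_perm, link_perm_perm]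
    exact h

/-- A semigroup supplies only positive powers, but by finiteness one of them is the identity at `f`.
-/
theorem link_self_mem {f : Frame n k} {σ : Equiv.Perm (Fin k)}
    (h : link f (f.perm σ) ∈ S) : link f f ∈ S := by
  have := link_perm_pow_mem h (orderOf σ - 1)
  rwa [Nat.sub_add_cancel (orderOf_pos σ), pow_orderOf_eq_one, Frame.perm_one] at this

/-- The group of a frame within a subsemigroup. -/
def loops (S : Subsemigroup (DifunRel n)) (f : Frame n k) (hf : link f f ∈ S) :
    Submonoid (Equiv.Perm (Fin k)) where
  carrier := {σ | link f (f.perm σ) ∈ S}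
  one_mem' := hf
  mul_mem' {σ τ} hσ hτ := by
    refine link_trans hτ ?_
    rw [← Frame.perm_perm, link_perm_perm]
    exact hσ

theorem mem_loops {f : Frame n k} {hf : link f f ∈ S} {σ : Equiv.Perm (Fin k)} :
    σ ∈ loops S f hf ↔ link f (f.perm σ) ∈ S := Iff.rfl

/-- In a finite group inverses are positive powers, so a generating set of the group also generates
it as a monoid. -/
theorem loops_eq_top {f : Frame n k} (hf : link f f ∈ S) {s : Set (Equiv.Perm (Fin k))}
    (hs : Subgroup.closure s = ⊤) (h : ∀ σ ∈ s, link f (f.perm σ) ∈ S) : loops S f hf = ⊤ := by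
  rw [eq_top_iff, ← Subgroup.top_toSubmonoid, ← hs, Subgroup.closure_toSubmonoid_of_finite,
    Submonoid.closure_le]
  exact h

/-- The steps of the cycle `F 0 → F 1 → ⋯ → F N → F 0` through frames, with a permutation
applied in the last step. -/
def cycleLink (F : Fin (N + 1) → Frame n k) (c : Equiv.Perm (Fin k)) (i : Fin (N + 1)) :
    DifunRel n :=
  link (F i) (Fin.lastCases (motive := fun _ => Frame n k) ((F 0).perm c) (fun j => F j.succ) i)

section cycle

variable {F : Fin (N + 1) → Frame n k} {c : Equiv.Perm (Fin k)}

theorem link_castSucc_mem (h : ∀ i, cycleLink F c i ∈ S) (i : Fin N) :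
    link (F i.castSucc) (F i.succ) ∈ S := by
  simpa [cycleLink] using h i.castSucc

theorem link_perm_zero_mem (h : ∀ i, cycleLink F c i ∈ S) (i : Fin (N + 1)) :
    link (F i) ((F 0).perm c) ∈ S := by
  refine Fin.reverseInduction ?_ (fun i ih => ?_) i
  · simpa [cycleLink] using h (Fin.last N)
  · exact link_trans (link_castSucc_mem h i) ih

theorem link_zero_self_mem (h : ∀ i, cycleLink F c i ∈ S) : link (F 0) (F 0) ∈ S :=
  link_self_mem (link_perm_zero_mem h 0)

theorem link_zero_left_mem (h : ∀ i, cycleLink F c i ∈ S) (i : Fin (N + 1)) :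
    link (F 0) (F i) ∈ S := by
  refine Fin.induction (link_zero_self_mem h) (fun i ih => ?_) i
  exact link_trans ih (link_castSucc_mem h i)

/-- Following the cycle to its end arrives at `F 0` twisted by `c`. The twist is undone by `c⁻¹`,
which is a power of the loop `c`. -/
theorem link_zero_right_mem (h : ∀ i, cycleLink F c i ∈ S) (i : Fin (N + 1)) :
    link (F i) (F 0) ∈ S := by
  have hc : c ∈ loops S (F 0) (link_zero_self_mem h) := link_perm_zero_mem h 0
  have hc' : c⁻¹ ∈ loops S (F 0) (link_zero_self_mem h) := by
    have h1 : c⁻¹ ∈ Submonoid.powers c :=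
      mem_powers_iff_mem_zpowers.2 (inv_mem (Subgroup.mem_zpowers c))
    exact (Submonoid.powers_le.2 hc) h1
  refine link_trans (link_perm_zero_mem h i) ?_
  rw [← link_perm_perm _ _ c⁻¹, Frame.perm_perm, mul_inv_cancel, Frame.perm_one]
  exact hc'

end cycle

/-- Any link is routed through the base frame `F 0`; the two reorderings are absorbed by the loop `τ
* σ⁻¹` there. -/
theorem link_mem_of_loops {F : Fin (N + 1) → Frame n k}
    (hF : ∀ f : Frame n k, ∃ i σ, f = (F i).perm σ) (h0 : link (F 0) (F 0) ∈ S)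
    (hl : loops S (F 0) h0 = ⊤) (h1 : ∀ i, link (F 0) (F i) ∈ S)
    (h2 : ∀ i, link (F i) (F 0) ∈ S) (f g : Frame n k) : link f g ∈ S := by
  obtain ⟨i, σ, rfl⟩ := hF f
  obtain ⟨j, τ, rfl⟩ := hF g
  rw [← link_perm_perm _ _ σ⁻¹, Frame.perm_perm, Frame.perm_perm, mul_inv_cancel, Frame.perm_one]
  refine link_trans (h2 i) (link_trans (mem_loops.1 (hl ▸ Submonoid.mem_top (τ * σ⁻¹) :
    τ * σ⁻¹ ∈ loops S (F 0) h0)) ?_)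
  rw [link_perm_perm]
  exact h1 j

/-- Connecting a non-full frame cyclically with all full frames of the same size generates, in
the presence of all elements of the next higher rank, all elements of the given rank. -/
theorem link_mem_of_cycle (hS : ∀ f g : Frame n (k + 1), link f g ∈ S)
    {F : Fin (N + 1) → Frame n k} (h0 : ¬ (F 0).IsFull)
    (hF : ∀ f : Frame n k, f.IsFull → ∃ i σ, f = (F i).perm σ)
    (h : ∀ i, cycleLink F 1 i ∈ S) (f g : Frame n k) : link f g ∈ S := by
  have h00 := link_zero_self_mem h
  -- Two non-full frames are linked by an element of rank `k + 1` that also pairs their complements;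
  -- multiplying by the identity at `F 0` discards that extra pair.
  have left : ∀ a : Frame n k, ¬ a.IsFull → link a (F 0) ∈ S := fun a ha => by
    have := link_mul_link_restrict (a.extend ha) ((F 0).extend h0) (Fin.succEmb k) (F 0)
    rw [Frame.restrict_extend, Frame.restrict_extend] at this
    exact this ▸ S.mul_mem (hS _ _) h00
  have right : ∀ a : Frame n k, ¬ a.IsFull → link (F 0) a ∈ S := fun a ha => by
    have := link_restrict_mul_link ((F 0).extend h0) (a.extend ha) (Fin.succEmb k) (F 0)
    rw [Frame.restrict_extend, Frame.restrict_extend] at this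
    exact this ▸ S.mul_mem h00 (hS _ _)
  have left' : ∀ a : Frame n k, link a (F 0) ∈ S := fun a => by
    by_cases ha : a.IsFull
    -- The reordered base frame is again non-full, so `left` undoes `σ`. All loops thus come from
    -- rank `k + 1`, and the cycle needs no twist.
    · obtain ⟨i, σ, rfl⟩ := hF a ha
      refine link_trans (g := (F 0).perm σ) ?_ (left _ (by rwa [Frame.isFull_perm]))
      rw [link_perm_perm]
      exact link_zero_right_mem h i
    · exact left a ha
  have right' : ∀ a : Frame n k, link (F 0) a ∈ S := fun a => by
    by_cases ha : a.IsFull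
    · obtain ⟨i, σ, rfl⟩ := hF a ha
      refine link_trans (g := (F 0).perm σ) (right _ (by rwa [Frame.isFull_perm])) ?_
      rw [link_perm_perm]
      exact link_zero_left_mem h i
    · exact right a ha
  exact link_trans (left' f) (right' g)

theorem rank_cycleLink (F : Fin (N + 1) → Frame n k) (c : Equiv.Perm (Fin k)) (i : Fin (N + 1)) :
    (cycleLink F c i).rank = k :=
  rank_link _ _

theorem ncard_range_cycleLink_le (F : Fin (N + 1) → Frame n k) (c : Equiv.Perm (Fin k)) :
    (Set.range (cycleLink F c)).ncard ≤ N + 1 := by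
  rw [← Set.image_univ]
  refine (Set.ncard_image_le (Set.toFinite _)).trans ?_
  rw [Set.ncard_univ, Nat.card_fin]

/-- Representatives, up to reordering, of a set of unordered partial partitions. -/
theorem exists_representatives (p : Frame n k → Prop)
    (hN : ((fun f : Frame n k => Set.range f) '' {f | p f}).ncard = N) :
    ∃ F : Fin N → Frame n k, ∀ f, p f → ∃ i σ, f = (F i).perm σ := by
  obtain ⟨e⟩ : Nonempty ((fun f : Frame n k => Set.range f) '' {f | p f} ≃ Fin N) :=
    ⟨Finite.equivFinOfCardEq ((Nat.card_coe_set_eq _).trans hN)⟩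
  have hs : ∀ i, ∃ f : Frame n k, p f ∧ Set.range f = e.symm i := fun i => (e.symm i).2
  choose s _ hs using hs
  refine ⟨s, fun f hf => ?_⟩
  have hmem : Set.range f ∈ (fun f : Frame n k => Set.range f) '' {f | p f} := ⟨f, hf, rfl⟩
  refine ⟨e ⟨Set.range f, hmem⟩, Frame.exists_perm_of_range_eq ?_⟩
  rw [hs, Equiv.symm_apply_apply]

theorem exists_generators_of_lt (h : k < n) :
    ∃ B : Set (DifunRel n), B.ncard ≤ Nat.stirlingSecond n k + 1 ∧ (∀ b ∈ B, b.rank = k) ∧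
      ∀ S : Subsemigroup (DifunRel n), B ⊆ S → (∀ f g : Frame n (k + 1), link f g ∈ S) →
        ∀ f g : Frame n k, link f g ∈ S := by
  obtain ⟨F, hF⟩ := exists_representatives Frame.IsFull (Frame.ncard_fullPartitions n k)
  let F' : Fin (Nat.stirlingSecond n k + 1) → Frame n k := Fin.cons (Frame.singletons h.le) F
  refine ⟨Set.range (cycleLink F' 1), ?_, ?_, fun S hB hS => ?_⟩
  · exact ncard_range_cycleLink_le F' 1
  · rintro _ ⟨i, rfl⟩
    exact rank_cycleLink _ _ _
  · refine link_mem_of_cycle hS (F := F') (Frame.not_isFull_singletons h) (fun f hf => ?_)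
      fun i => hB ⟨i, rfl⟩
    obtain ⟨i, σ, h⟩ := hF f hf
    exact ⟨i.succ, σ, by simpa [F'] using h⟩

theorem closure_finRotate {r : ℕ} (h : r ≤ 2) :
    Subgroup.closure {finRotate r} = (⊤ : Subgroup (Equiv.Perm (Fin r))) := by
  rw [← Subgroup.zpowers_eq_closure, eq_top_iff]
  rintro σ -
  interval_cases r
  · exact ⟨0, Subsingleton.elim _ _⟩
  · exact ⟨0, Subsingleton.elim _ _⟩
  · have : ∀ σ : Equiv.Perm (Fin 2), σ = 1 ∨ σ = finRotate 2 := by decide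
    rcases this σ with rfl | rfl
    · exact one_mem _
    · exact Subgroup.mem_zpowers _

theorem closure_finRotate_swap {r : ℕ} (h : 2 ≤ r) : ∃ τ : Equiv.Perm (Fin r),
    Subgroup.closure {finRotate r, τ} = (⊤ : Subgroup (Equiv.Perm (Fin r))) :=
  ⟨_, Equiv.Perm.closure_cycle_adjacent_swap (isCycle_finRotate_of_le h)
    (support_finRotate_of_le h) ⟨0, by omega⟩⟩

theorem exists_generators_top {r : ℕ} (h : r ≤ n) :
    ∃ B : Set (DifunRel n), B.ncard ≤ (Frame.partitions n r).ncard + (if 3 ≤ r then 1 else 0) ∧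
      (∀ b ∈ B, b.rank = r) ∧
      ∀ S : Subsemigroup (DifunRel n), B ⊆ S → ∀ f g : Frame n r, link f g ∈ S := by
  have hO : (fun f : Frame n r => Set.range f) '' {f | True} = Frame.partitions n r := by
    simp [Frame.partitions]
  obtain ⟨N, hN⟩ : ∃ N, (Frame.partitions n r).ncard = N + 1 :=
    Nat.exists_eq_succ_of_ne_zero (Set.ncard_ne_zero_of_mem ⟨Frame.singletons h, rfl⟩)
  rw [hN]
  obtain ⟨F, hF⟩ := exists_representatives (fun _ : Frame n r => True) (hO.symm ▸ hN)
  have hF' : ∀ f, ∃ i σ, f = (F i).perm σ := fun f => hF f trivial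
  by_cases h3 : 3 ≤ r
  -- The cycle itself yields the rotation as a loop at `F 0`; adding the loop `τ` gives the full
  -- symmetric group.
  · obtain ⟨τ, hτ⟩ := closure_finRotate_swap (show 2 ≤ r by omega)
    refine ⟨insert (link (F 0) ((F 0).perm τ)) (Set.range (cycleLink F (finRotate r))), ?_, ?_,
      fun S hB => ?_⟩
    · rw [if_pos h3]
      exact (Set.ncard_insert_le _ _).trans (Nat.add_le_add_right (ncard_range_cycleLink_le _ _) 1)
    · rintro _ (rfl | ⟨i, rfl⟩)
      · exact rank_link _ _
      · exact rank_cycleLink _ _ _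
    · have hc : ∀ i, cycleLink F (finRotate r) i ∈ S := fun i => hB (Or.inr ⟨i, rfl⟩)
      refine link_mem_of_loops hF' (link_zero_self_mem hc) (loops_eq_top _ hτ ?_)
        (link_zero_left_mem hc) (link_zero_right_mem hc)
      rintro σ (rfl | rfl)
      · exact link_perm_zero_mem hc 0
      · exact hB (Or.inl rfl)
  · refine ⟨Set.range (cycleLink F (finRotate r)), ?_, ?_, fun S hB => ?_⟩
    · rw [if_neg h3]
      exact ncard_range_cycleLink_le _ _
    · rintro _ ⟨i, rfl⟩
      exact rank_cycleLink _ _ _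
    · have hc : ∀ i, cycleLink F (finRotate r) i ∈ S := fun i => hB ⟨i, rfl⟩
      refine link_mem_of_loops hF' (link_zero_self_mem hc)
        (loops_eq_top _ (closure_finRotate (show r ≤ 2 by omega)) ?_)
        (link_zero_left_mem hc) (link_zero_right_mem hc)
      rintro σ rfl
      exact link_perm_zero_mem hc 0

/-- The cardinality of a minimal generating set of `idealRank n r`, sorted by rank. -/
noncomputable def generatorCount (n r : ℕ) : ℕ :=
  (Frame.partitions n r).ncard + (if 3 ≤ r then 1 else 0) +
    ∑ k ∈ Finset.Ico 1 r, (Nat.stirlingSecond n k + 1)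

theorem exists_generators {r : ℕ} (hn : 2 ≤ n) (hr : r ≤ n) :
    ∃ B : Set (DifunRel n), Subsemigroup.closure B = idealRank n r ∧
      B.ncard ≤ generatorCount n r := by
  obtain ⟨T, hT, hTr, hTS⟩ := exists_generators_top hr
  have hlow : ∀ k, ∃ B : Set (DifunRel n), k < n → B.ncard ≤ Nat.stirlingSecond n k + 1 ∧
      (∀ b ∈ B, b.rank = k) ∧
      ∀ S : Subsemigroup (DifunRel n), B ⊆ S → (∀ f g : Frame n (k + 1), link f g ∈ S) →
        ∀ f g : Frame n k, link f g ∈ S := fun k => by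
    by_cases h : k < n
    · obtain ⟨B, hB⟩ := exists_generators_of_lt h
      exact ⟨B, fun _ => hB⟩
    · exact ⟨∅, fun h' => absurd h' h⟩
  choose L hL using hlow
  refine ⟨T ∪ ⋃ k ∈ Finset.Ico 1 r, L k, le_antisymm ?_ ?_, ?_⟩
  · rw [Subsemigroup.closure_le]
    rintro α (hα | hα)
    · exact (hTr α hα).le
    · simp only [Set.mem_iUnion, Finset.mem_Ico] at hα
      obtain ⟨k, hk, hα⟩ := hα
      exact ((hL k (by omega)).2.1 α hα).trans_le hk.2.le
  · set S := Subsemigroup.closure (T ∪ ⋃ k ∈ Finset.Ico 1 r, L k) with hS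
    have hsub : T ∪ ⋃ k ∈ Finset.Ico 1 r, L k ⊆ S := Subsemigroup.subset_closure
    have hpos : ∀ k, 1 ≤ k → k ≤ r → ∀ f g : Frame n k, link f g ∈ S := by
      intro k hk hkr
      induction hkr using Nat.decreasingInduction with
      | self => exact hTS S (Set.subset_union_left.trans hsub)
      | of_succ k hkr ih =>
        refine (hL k (by omega)).2.2 S (fun α hα => hsub (Or.inr ?_)) (ih (by omega))
        simp only [Set.mem_iUnion, Finset.mem_Ico]
        exact ⟨k, ⟨hk, hkr⟩, hα⟩
    intro α hα
    obtain ⟨f, g, hfg⟩ := α.exists_link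
    have hα' : α.rank ≤ r := hα
    rw [hfg]
    generalize α.rank = k at f g hα'
    rcases Nat.eq_zero_or_pos k with rfl | hk
    · rcases Nat.eq_zero_or_pos r with rfl | hr0
      · exact hTS S (Set.subset_union_left.trans hsub) _ _
      -- Two different singletons, available as `n ≥ 2`, are blocks that never match, so the product
      -- is empty.
      · let f0 : Frame n 1 := (Frame.singletons hn).restrict ⟨fun _ => 0, fun _ _ _ => Subsingleton.elim _ _⟩
        let f1 : Frame n 1 :=
          (Frame.singletons hn).restrict ⟨fun _ => 1, Function.injective_of_subsingleton _⟩
        have : link f g = link f0 f0 * link f1 f1 := by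
          ext ⟨x, y⟩
          rw [mem_link, mem_mul]
          constructor
          · rintro ⟨i, -⟩
            exact i.elim0
          · rintro ⟨h, z, hz⟩
            have hz' : (z, y) ∈ (link f1 f1).rel := (Set.ext_iff.1 h z).1 hz
            obtain ⟨i, -, hi⟩ := mem_link.1 hz
            obtain ⟨j, hj, -⟩ := mem_link.1 hz'
            exact absurd ((Frame.singletons hn).index_eq hi hj) (zero_ne_one (α := Fin 2))
        rw [this]
        exact S.mul_mem (hpos 1 le_rfl hr0 _ _) (hpos 1 le_rfl hr0 _ _)
    · exact hpos k hk hα' f g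
  · refine (Set.ncard_union_le _ _).trans (Nat.add_le_add hT ?_)
    refine (Finset.set_ncard_biUnion_le _ _).trans (Finset.sum_le_sum fun k hk => ?_)
    have := Finset.mem_Ico.1 hk
    exact (hL k (by omega)).1

end DifunRel

/-! ### Lower bound: generators needed in each rank -/

/-- `IsProd A m x` means that `x` is a product of `m + 1` elements of `A`. -/
inductive IsProd {M : Type*} [Mul M] (A : Set M) : ℕ → M → Prop
  | of {a : M} : a ∈ A → IsProd A 0 a
  | cons {m : ℕ} {a x : M} : a ∈ A → IsProd A m x → IsProd A (m + 1) (a * x)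

namespace IsProd

variable {M : Type*} [Semigroup M] {A : Set M}

theorem mul {m l : ℕ} {x y : M} (hx : IsProd A m x) (hy : IsProd A l y) :
    IsProd A (m + l + 1) (x * y) := by
  induction hx with
  | of ha =>
    rw [Nat.zero_add]
    exact cons ha hy
  | @cons m a x ha _ ih =>
    rw [mul_assoc, Nat.add_right_comm m 1 l]
    exact cons ha ih

theorem exists_of_mem_closure {x : M} (h : x ∈ Subsemigroup.closure A) : ∃ m, IsProd A m x := by
  induction h using Subsemigroup.closure_induction with
  | mem x hx => exact ⟨0, of hx⟩
  | mul x y _ _ hx hy =>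
    obtain ⟨m, hm⟩ := hx
    obtain ⟨l, hl⟩ := hy
    exact ⟨_, hm.mul hl⟩

theorem mem_closure {m : ℕ} {x : M} (h : IsProd A m x) : x ∈ Subsemigroup.closure A := by
  induction h with
  | of ha => exact Subsemigroup.subset_closure ha
  | cons ha _ ih => exact Subsemigroup.mul_mem _ (Subsemigroup.subset_closure ha) ih

end IsProd

namespace DifunRel

variable {n k r : ℕ} {A : Set (DifunRel n)}

/-- The kernel of a product is contained in that of its first factor. -/
theorem exists_kernel_subset {α : DifunRel n} (h : α ∈ Subsemigroup.closure A) :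
    ∃ a ∈ A, α.rel.kernel ⊆ a.rel.kernel := by
  induction h using Subsemigroup.closure_induction with
  | mem x hx => exact ⟨x, hx, subset_rfl⟩
  | mul x y _ _ hx _ =>
    obtain ⟨a, ha, h⟩ := hx
    exact ⟨a, ha, (kernel_mul_subset x y).trans h⟩

theorem link_mem_closure (hA : Subsemigroup.closure A = idealRank n r) (hk : k ≤ r)
    (f g : Frame n k) : link f g ∈ Subsemigroup.closure A := by
  rw [hA]
  exact (rank_link f g).trans_le hk

theorem rank_le_of_mem_closure (hA : Subsemigroup.closure A = idealRank n r) {α : DifunRel n}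
    (h : α ∈ Subsemigroup.closure A) : α.rank ≤ r := by
  rw [hA] at h
  exact h

theorem partitions_subset (hA : Subsemigroup.closure A = idealRank n r) :
    Frame.partitions n r ⊆ (fun a : DifunRel n => a.rel.kernel) '' {a ∈ A | a.rank = r} := by
  rintro _ ⟨f, rfl⟩
  obtain ⟨a, ha, hfa⟩ := exists_kernel_subset (link_mem_closure hA le_rfl f f)
  have har := rank_le_of_mem_closure hA (Subsemigroup.subset_closure ha)
  have heq := Set.eq_of_subset_of_ncard_le hfa
    (har.trans_eq (rank_link f f).symm) (Set.toFinite _)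
  rw [kernel_link] at heq
  refine ⟨a, ⟨ha, ?_⟩, heq.symm⟩
  rw [rank_eq_ncard_kernel, ← heq, Set.ncard_range_of_injective f.injective, Nat.card_fin]

/-- If each partial partition with `r` blocks is the kernel of only one generator, then a product
of rank `r` is determined by its kernel and its length. -/
theorem isProd_unique (hA : Subsemigroup.closure A = idealRank n r)
    (hinj : Set.InjOn (fun a : DifunRel n => a.rel.kernel) {a ∈ A | a.rank = r}) {m : ℕ}
    {α β : DifunRel n} (hα : IsProd A m α) (hβ : IsProd A m β) (hαr : α.rank = r)
    (hβr : β.rank = r) (h : α.rel.kernel = β.rel.kernel) : α = β := by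
  induction hα generalizing β with
  | of ha =>
    cases hβ with
    | of hb => exact hinj ⟨ha, hαr⟩ ⟨hb, hβr⟩ h
  | @cons m a x ha hx ih =>
    cases hβ with
    | @cons _ b y hb hy =>
      have split : ∀ {c z : DifunRel n}, c ∈ A → IsProd A m z → (c * z).rank = r →
          c.rank = r ∧ z.rank = r ∧ (c * z).rel.kernel = c.rel.kernel ∧
            z.rel.kernel = c.cokernel := by
        intro c z hc hz hcz
        have hcr := (rank_le_of_mem_closure hA (Subsemigroup.subset_closure hc)).antisymm
          (hcz.symm.trans_le (rank_mul_le_left c z))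
        have hzr := (rank_le_of_mem_closure hA hz.mem_closure).antisymm
          (hcz.symm.trans_le (rank_mul_le_right c z))
        exact ⟨hcr, hzr, kernel_mul_eq (by rw [hcr, hcz]),
          cokernel_eq_kernel (by rw [hzr, hcz]) (by rw [hcr, hzr])⟩
      obtain ⟨har, hxr, hk, hc⟩ := split ha hx hαr
      obtain ⟨hbr, hyr, hk', hc'⟩ := split hb hy hβr
      -- Equal kernels force the same first factor; the remaining products then both have its
      -- cokernel as kernel, and induction applies.
      obtain rfl : a = b := hinj ⟨ha, har⟩ ⟨hb, hbr⟩ (hk.symm.trans (h.trans hk'))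
      rw [ih hy hxr hyr (hc.trans hc'.symm)]

theorem exists_perm_not_commute (h : 3 ≤ r) :
    ∃ σ τ : Equiv.Perm (Fin r), σ * τ ≠ τ * σ := by
  let a : Fin r := ⟨0, by omega⟩
  let b : Fin r := ⟨1, by omega⟩
  let c : Fin r := ⟨2, by omega⟩
  have hab : a ≠ b := by simp [a, b]
  have hbc : b ≠ c := by simp [b, c]
  have hac : a ≠ c := by simp [a, c]
  refine ⟨Equiv.swap a b, Equiv.swap b c, fun H => ?_⟩
  have := congrArg (fun σ : Equiv.Perm (Fin r) => σ a) H
  simp only [Equiv.Perm.mul_apply, Equiv.swap_apply_left, Equiv.swap_apply_of_ne_of_ne hab hac]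
    at this
  exact hbc this

theorem ncard_partitions_add_le (hr : r ≤ n) (hA : Subsemigroup.closure A = idealRank n r) :
    (Frame.partitions n r).ncard + (if 3 ≤ r then 1 else 0) ≤ {a ∈ A | a.rank = r}.ncard := by
  have h1 := Set.ncard_le_ncard (partitions_subset hA) (Set.toFinite _)
  have h2 := Set.ncard_image_le (f := fun a : DifunRel n => a.rel.kernel)
    (Set.toFinite {a ∈ A | a.rank = r})
  by_cases h3 : 3 ≤ r
  · rw [if_pos h3]
    refine Nat.succ_le_of_lt ((h1.trans h2).lt_of_ne fun heq => ?_)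
    have hinj := Set.injOn_of_ncard_image_eq (h2.antisymm (heq.symm.trans_le h1)) (Set.toFinite _)
    obtain ⟨σ, τ, hστ⟩ := exists_perm_not_commute h3
    let f := Frame.singletons hr
    obtain ⟨m, hm⟩ := IsProd.exists_of_mem_closure (link_mem_closure hA le_rfl f (f.perm σ))
    obtain ⟨l, hl⟩ := IsProd.exists_of_mem_closure (link_mem_closure hA le_rfl f (f.perm τ))
    have key : ∀ ρ π : Equiv.Perm (Fin r),
        link f (f.perm ρ) * link f (f.perm π) = link f (f.perm (π * ρ)) := by
      intro ρ π
      rw [← link_perm_perm f (f.perm π) ρ, Frame.perm_perm, link_mul_link]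
    -- The two loops multiplied in either order give words of the same length with the same kernel,
    -- so they would commute.
    have hml := hm.mul hl
    have hlm := hl.mul hm
    rw [Nat.add_comm l m] at hlm
    rw [key] at hml hlm
    have := isProd_unique hA hinj hml hlm (rank_link _ _) (rank_link _ _)
      (by rw [kernel_link, kernel_link])
    exact hστ (f.perm_injective (link_right_injective this)).symm
  · rw [if_neg h3]
    exact h1.trans h2

/-- A covering family of blocks cannot be properly contained in a larger disjoint one, so the
generator from `exists_kernel_subset` has exactly this kernel and hence rank `k`. -/
theorem fullPartitions_subset (hk : k ≤ r) (hA : Subsemigroup.closure A = idealRank n r) :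
    Frame.fullPartitions n k ⊆ (fun a : DifunRel n => a.rel.kernel) '' {a ∈ A | a.rank = k} := by
  rintro _ ⟨f, hf, rfl⟩
  obtain ⟨a, ha, hfa⟩ := exists_kernel_subset (link_mem_closure hA hk f f)
  rw [kernel_link] at hfa
  have heq := kernel_eq_of_subset ((Frame.isFull_iff_sUnion f).1 hf) hfa
  refine ⟨a, ⟨ha, ?_⟩, heq.symm⟩
  rw [rank_eq_ncard_kernel, ← heq, Set.ncard_range_of_injective f.injective, Nat.card_fin]

/-- A product leading from a non-full partial partition to a full one of the same size has a
factor whose kernel is a non-full partial partition of the same size. -/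
theorem exists_not_full_of_mem_closure {α : DifunRel n} (h : α ∈ Subsemigroup.closure A)
    (hα : α.rank = k) (hker : ⋃₀ α.rel.kernel ≠ Set.univ) (hcoker : ⋃₀ α.cokernel = Set.univ) :
    ∃ a ∈ A, a.rank = k ∧ ⋃₀ a.rel.kernel ≠ Set.univ := by
  induction h using Subsemigroup.closure_induction with
  | mem x hx => exact ⟨x, hx, hα, hker⟩
  | mul x y _ _ hx hy =>
    have hco := cokernel_eq_of_subset hcoker (cokernel_mul_subset x y)
    have hyk : y.rank = k := by rw [← ncard_cokernel, ← hco, ncard_cokernel, hα]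
    -- The passage from non-full to full happens either inside `y` or, if the kernel of `y` is
    -- already full, inside `x`.
    by_cases hyf : ⋃₀ y.rel.kernel = Set.univ
    · have hyx := cokernel_eq_of_subset hyf (kernel_subset_cokernel (α := x) (by rw [hyk, hα]))
      have hxk : x.rank = k := by rw [← ncard_cokernel, ← hyx, ← rank_eq_ncard_kernel, hyk]
      rw [kernel_mul_eq (by rw [hxk, hα])] at hker
      exact hx hxk hker (hyx ▸ hyf)
    · exact hy hyk hyf (hco ▸ hcoker)

/-- Besides the full kernels, some non-full kernel of rank `k` must occur, since the non-full frame
of singletons is linked to a full frame `q`. -/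
theorem stirlingSecond_add_one_le (hk : 1 ≤ k) (hkr : k < r) (hr : r ≤ n)
    (hA : Subsemigroup.closure A = idealRank n r) :
    Nat.stirlingSecond n k + 1 ≤ {a ∈ A | a.rank = k}.ncard := by
  obtain ⟨q, hq⟩ : ∃ q : Frame n k, q.IsFull := by
    obtain ⟨l, rfl⟩ := Nat.exists_eq_succ_of_ne_zero (Nat.one_le_iff_ne_zero.1 hk)
    exact ⟨_, Frame.isFull_extend _ (Frame.not_isFull_singletons (show l < n by omega))⟩
  have hkn : k < n := hkr.trans_le hr
  obtain ⟨a, ha, hak, haf⟩ := exists_not_full_of_mem_closure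
    (link_mem_closure hA hkr.le (Frame.singletons hkn.le) q) (rank_link _ _)
    (by rw [kernel_link, Ne, ← Frame.isFull_iff_sUnion]; exact Frame.not_isFull_singletons hkn)
    (by rwa [cokernel_link, ← Frame.isFull_iff_sUnion])
  have hnot : a.rel.kernel ∉ Frame.fullPartitions n k := by
    rintro ⟨f, hf, h⟩
    exact haf (h ▸ (Frame.isFull_iff_sUnion f).1 hf)
  rw [← Frame.ncard_fullPartitions, ← Set.ncard_insert_of_notMem hnot (Set.toFinite _)]
  refine (Set.ncard_le_ncard ?_ (Set.toFinite _)).trans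
    (Set.ncard_image_le (f := fun a : DifunRel n => a.rel.kernel) (Set.toFinite _))
  exact Set.insert_subset ⟨a, ⟨ha, hak⟩, rfl⟩ (fullPartitions_subset hkr.le hA)

theorem generatorCount_le (hr : r ≤ n) (hA : Subsemigroup.closure A = idealRank n r) :
    generatorCount n r ≤ A.ncard := by
  classical
  have hfin := Set.toFinite A
  have hcard : ∀ k, {a ∈ A | a.rank = k}.ncard = (hfin.toFinset.filter (rank · = k)).card :=
    fun k => by
      rw [← Set.ncard_coe_finset]
      congr 1
      ext a
      simp
  -- Inserting `r` into the interval also covers `r = 0`, where only rank 0 remains.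
  have hsum : ∑ k ∈ insert r (Finset.Ico 1 r), {a ∈ A | a.rank = k}.ncard ≤ A.ncard := by
    rw [Set.ncard_eq_toFinset_card A hfin, Finset.sum_congr rfl fun k _ => hcard k,
      ← Finset.card_biUnion fun k _ l _ hkl => Finset.disjoint_filter.2
        fun a _ h h' => hkl (h.symm.trans h')]
    exact Finset.card_le_card (Finset.biUnion_subset.2 fun k _ => Finset.filter_subset _ _)
  refine le_trans ?_ hsum
  rw [Finset.sum_insert (by simp)]
  refine Nat.add_le_add (ncard_partitions_add_le hr hA) (Finset.sum_le_sum fun k hk => ?_)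
  have := Finset.mem_Ico.1 hk
  exact stirlingSecond_add_one_le this.1 this.2 hr hA

theorem generatorCount_eq (hn : 2 ≤ n) :
    generatorCount n r = if r = 1 ∨ r = 2 then difunRho n r - 1 else difunRho n r := by
  rw [generatorCount, Frame.ncard_partitions, difunRho]
  rcases Nat.eq_zero_or_pos r with rfl | hr
  · obtain ⟨m, rfl⟩ := Nat.exists_eq_add_of_le' (show 1 ≤ n by omega)
    simp
  -- The `r - 1` extra generators in lower ranks fall one short of the summand `r` in `difunRho`;
  -- the extra loop for `r ≥ 3` makes up the difference.
  · rw [← Finset.Ico_insert_right hr, Finset.sum_insert (by simp),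
      Finset.sum_add_distrib, Finset.sum_const, Nat.card_Ico, smul_eq_mul, mul_one]
    split_ifs <;> omega

end DifunRel

/-! ### Passing to the rank of the ideal -/

/-- The rank of a subsemigroup, computed with generating sets in the ambient finite semigroup. -/
theorem Subsemigroup.rank_eq {M : Type*} [Semigroup M] [Finite M] (S : Subsemigroup M) (c : ℕ)
    (h : ∃ B : Set M, Subsemigroup.closure B = S ∧ B.ncard ≤ c)
    (h' : ∀ B : Set M, Subsemigroup.closure B = S → c ≤ B.ncard) :
    Semigroup.rank S = c := by
  have hmk : ∀ A : Set S, Cardinal.mk A = (((↑) '' A : Set M).ncard : Cardinal) := fun A => by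
    rw [← Set.cast_ncard (Set.toFinite A), Set.ncard_image_of_injective _ Subtype.val_injective]
  have hmap : ∀ A : Set S, Subsemigroup.map (MulMemClass.subtype S) (Subsemigroup.closure A) =
      Subsemigroup.closure ((↑) '' A : Set M) := fun A => MulHom.map_mclosure _ _
  have hle : ∀ A : Set S, Subsemigroup.closure A = ⊤ →
      Subsemigroup.closure ((↑) '' A : Set M) = S := fun A hA => by
    rw [← hmap, hA]
    ext x
    simp
  obtain ⟨B, hB, hBc⟩ := h
  have hBS : B ⊆ S := hB ▸ Subsemigroup.subset_closure
  have himg : ((↑) '' ((↑) ⁻¹' B : Set S) : Set M) = B := by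
    ext x
    simp only [Set.mem_image, Set.mem_preimage]
    exact ⟨fun ⟨y, hy, hyx⟩ => hyx ▸ hy, fun hx => ⟨⟨x, hBS hx⟩, hx, rfl⟩⟩
  have htop : Subsemigroup.closure ((↑) ⁻¹' B : Set S) = ⊤ := by
    have h1 := hmap ((↑) ⁻¹' B : Set S)
    rw [himg, hB] at h1
    rw [eq_top_iff]
    rintro ⟨x, hx⟩ -
    obtain ⟨y, hy, hyx⟩ := h1.symm ▸ hx
    exact (Subtype.ext hyx : y = ⟨x, hx⟩) ▸ hy
  rw [Semigroup.rank]
  apply le_antisymm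
  · refine (csInf_le' (a := Cardinal.mk ((↑) ⁻¹' B : Set S))
      (show _ ∈ {c | ∃ A : Set S, _} from ⟨_, htop, rfl⟩)).trans ?_
    rw [hmk, himg]
    exact Nat.cast_le.2 hBc
  · refine le_csInf ⟨_, _, htop, rfl⟩ ?_
    rintro _ ⟨A, hA, rfl⟩
    rw [hmk]
    exact Nat.cast_le.2 (h' _ (hle A hA))

theorem proposition2p2 (n r : ℕ) (hn : 2 ≤ n) (hr : r ≤ n) :
    ((r = 0 ∨ 3 ≤ r) →
      Semigroup.rank (DifunRel.idealRank n r) = (difunRho n r : Cardinal)) ∧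
    ((r = 1 ∨ r = 2) →
      Semigroup.rank (DifunRel.idealRank n r) = ((difunRho n r - 1 : ℕ) : Cardinal)) := by
  have h := Subsemigroup.rank_eq (DifunRel.idealRank n r) (DifunRel.generatorCount n r)
    (DifunRel.exists_generators hn hr) fun B hB => DifunRel.generatorCount_le hr hB
  rw [DifunRel.generatorCount_eq hn] at h
  refine ⟨fun h0 => ?_, fun h1 => ?_⟩
  · rwa [if_neg (by omega)] at h
  · rwa [if_pos h1] at h
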